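/- Let $n,m\ge 1$, let $(\Omega,\mathcal F,P)$ be a probability space and let $A$ be a random real $n\times m$ matrix whose rows $a(1),\dots,a(n)\in\mathbb R^m$ are independent (not necessarily identically distributed) random vectors satisfying, almost surely, $\|a(l)\|_2\le K\sqrt m$ for all $l=1,\dots,n$, where $K\ge 1$ is a constant. Let $\|\cdot\|$ denote the spectral norm of a matrix, put $\Lambda_A=\frac1n\|\mathbb E[A^TA]\|$ and assume $\Lambda_A>0$. Set $$\tau=\frac{\sqrt{17}+1}{4},\qquad X=\Big\|\frac{A^TA-\mathbb E[A^TA]}{n\Lambda_A}\Big\|,\qquad \Sigma_{r,m,n}=\Big(\frac{2K}{\sqrt{\Lambda_A}}\sqrt{\frac mn}\Big)^{r}\,2^{3/4}\,m\,r^{r/2}e^{-r/2}\quad(r>0).$$ 1. (Moments.) For every real $r\ge 2$ with $\Sigma_{r,m,n}^{1/r}\le \frac12$, the variable $X^r$ is integrable and $$\big(\mathbb E[X^r]\big)^{1/r}\le \tau\,\Sigma_{r,m,n}^{1/r}.$$ 2. (Tail.) For every real $u\ge\sqrt2$ such that $\Sigma_{r,m,n}^{1/r}\le\frac12$ for $r=u^2$,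 $$P\Big(X>\frac{2\tau K}{\sqrt{\Lambda_A}}\sqrt{\frac mn}\,u\Big)\le 2^{3/4}\,m\,e^{-u^2/2}.$$ 3. (Tail in terms of the confidence level.) For every $0<\delta<\frac12$ such that $\Sigma_{r,m,n}^{1/r}\le\frac12$ for $r=2\log(2^{3/4}m/\delta)$, with probability at least $1-\delta$, $$X\le\frac{2\tau K}{\sqrt{\Lambda_A}}\sqrt{\frac mn}\,\sqrt{2\log(2^{3/4}m/\delta)}.$$ -/

import Mathlib

open MeasureTheory ProbabilityTheory
open scoped Matrix

noncomputable section

namespace RandomGram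

/-- The spectral norm of a square real matrix: the operator norm on Euclidean space. -/
def specNorm {m : ℕ} (M : Matrix (Fin m) (Fin m) ℝ) : ℝ :=
  ‖Matrix.toEuclideanCLM (n := Fin m) (𝕜 := ℝ) M‖

/-- The Euclidean norm of a vector of `ℝ ^ m`. -/
def euclNorm {m : ℕ} (v : Fin m → ℝ) : ℝ :=
  ‖(WithLp.toLp 2 v : EuclideanSpace ℝ (Fin m))‖

variable {Ω : Type*} [MeasurableSpace Ω] {n m : ℕ}

/-- The matrix `E[Aᵀ A]`, the expectation being taken entry by entry. -/
def meanGram (P : Measure Ω) (A : Ω → Matrix (Fin n) (Fin m) ℝ) : Matrix (Fin m) (Fin m) ℝ :=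
  Matrix.of fun i j => ∫ ω, ((A ω)ᵀ * A ω) i j ∂P

/-- `Λ_A = ‖E[Aᵀ A]‖ / n`. -/
def Lam (P : Measure Ω) (A : Ω → Matrix (Fin n) (Fin m) ℝ) : ℝ :=
  (1 / (n : ℝ)) * specNorm (meanGram P A)

/-- The normalised deviation `‖(Aᵀ A - E[Aᵀ A]) / (n Λ_A)‖`, a real random variable. -/
def normDev (P : Measure Ω) (A : Ω → Matrix (Fin n) (Fin m) ℝ) (ω : Ω) : ℝ :=
  specNorm ((1 / ((n : ℝ) * Lam P A)) • ((A ω)ᵀ * A ω - meanGram P A))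

/-- `τ = (√17 + 1) / 4`. -/
def tau : ℝ := (Real.sqrt 17 + 1) / 4

/-- `Σ_{r,m,n} = ((2 K / √Λ) √(m / n)) ^ r * 2 ^ (3/4) * m * r ^ (r/2) * e ^ (-r/2)`,
as a function of `m`, `n`, `K`, `Λ` and the real exponent `r`. -/
def Sig (m n : ℕ) (K Λ r : ℝ) : ℝ :=
  (2 * K / Real.sqrt Λ * Real.sqrt ((m : ℝ) / (n : ℝ))) ^ r
    * (2 : ℝ) ^ (3 / 4 : ℝ) * (m : ℝ) * r ^ (r / 2) * Real.exp (-r / 2)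

end RandomGram

end

/-!
The proof bounds the moments of `X = ‖AᵀA - E[AᵀA]‖ / (n Λ)` by symmetrization and a Khintchine
inequality for rank-one matrices, and then closes up a self-bounding inequality for `‖X‖_r`.

*Symmetrization.* The rows are independent, so their joint law is a product measure. Jensen's
inequality (`specNorm_sub_mean_rpow_le`) replaces the mean by an independent copy of the Gram
matrix, and exchanging rows between the two copies introduces arbitrary signs
(`integral_specNorm_sub_mean_rpow_le`):
`E ‖AᵀA - E[AᵀA]‖ ^ r ≤ 2 ^ r E ‖∑ ε l • a(l) a(l)ᵀ‖ ^ r` for every choice of signs `ε`.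

*Khintchine.* For fixed rows with `|x l| ^ 2 ≤ a`, put `S ε = ∑ ε l • x l (x l)ᵀ`. Flipping one sign
at a time and expanding the difference of the powers, `tr (S ε) ^ (2p + 2)` is, on average over
`ε`, a sum of products `⟨x l, W ^ q x l⟩ ⟨x l, Y ^ (2p - q) x l⟩` with `W`, `Y` symmetric. Both
factors are moments of spectral measures, and pairing `q` with `2p - q` bounds their sum by top
moments (`sum_moment_mul_moment_le`). This gives
`E tr (S ε) ^ (2p + 2) ≤ (2p + 1) a ‖xᵀx‖ E tr (S ε) ^ (2p)`, hence Gaussian constants for the even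
moments (`sum_specNorm_signedGram_pow_le`). Stirling's formula and log-convexity of moments extend
the bound to real exponents `r ≥ 2` with the constant `2 ^ (3/4) m r ^ (r/2) e ^ (-r/2)`
(`sum_specNorm_signedGram_rpow_le`).

*Self-bounding.* The norm `‖AᵀA‖` in the Khintchine bound is at most `n Λ (1 + X)`, so that
`E[X ^ r] ≤ Σ E[(1 + X) ^ (r/2)]` (`integral_normDev_rpow_le`). With `x = ‖X‖_r` and `s = Σ ^ (1/r)`
this yields `x ^ 2 ≤ s ^ 2 (1 + x)`, and `s ≤ 1/2` forces `x ≤ τ s`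
(`rpow_inv_integral_le_of_self_bound`). The tail bounds are Markov's inequality for `X ^ r`
(`tail_le_of_moment_le`), with `r = u ^ 2` and `r = 2 log (2 ^ (3/4) m / δ)`.
-/

namespace RandomGram

/-! ### Moments of symmetric matrices -/

/-- The difference of the two sides is at least `(|a| ^ q - |b| ^ q) (|a| ^ s - |b| ^ s) ≥ 0`. -/
theorem pow_mul_pow_add_le_of_even {q s : ℕ} (h : Even (q + s)) (a b : ℝ) :
    a ^ q * b ^ s + a ^ s * b ^ q ≤ a ^ (q + s) + b ^ (q + s) := by
  have key : 0 ≤ (|a| ^ q - |b| ^ q) * (|a| ^ s - |b| ^ s) := by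
    rcases le_total |a| |b| with hab | hab
    · exact mul_nonneg_of_nonpos_of_nonpos
        (sub_nonpos.2 (pow_le_pow_left₀ (abs_nonneg _) hab _))
        (sub_nonpos.2 (pow_le_pow_left₀ (abs_nonneg _) hab _))
    · exact mul_nonneg (sub_nonneg.2 (pow_le_pow_left₀ (abs_nonneg _) hab _))
        (sub_nonneg.2 (pow_le_pow_left₀ (abs_nonneg _) hab _))
  have h1 : a ^ q * b ^ s ≤ |a| ^ q * |b| ^ s := by
    rw [← abs_pow, ← abs_pow, ← abs_mul]; exact le_abs_self _
  have h2 : a ^ s * b ^ q ≤ |a| ^ s * |b| ^ q := by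
    rw [← abs_pow, ← abs_pow, ← abs_mul]; exact le_abs_self _
  rw [← h.pow_abs a, ← h.pow_abs b, pow_add, pow_add]
  nlinarith

section LinearAlgebra

variable {n m : ℕ}

theorem isHermitian_pow_eq {W : Matrix (Fin m) (Fin m) ℝ} (hW : W.IsHermitian) (q : ℕ) :
    W ^ q = (hW.eigenvectorUnitary : Matrix (Fin m) (Fin m) ℝ)
      * Matrix.diagonal (hW.eigenvalues ^ q)
      * (hW.eigenvectorUnitary : Matrix (Fin m) (Fin m) ℝ)ᵀ := by
  conv_lhs => rw [hW.spectral_theorem]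
  rw [← map_pow, Unitary.conjStarAlgAut_apply, Matrix.diagonal_pow]
  rfl

/-- The spectral measure of a symmetric matrix at a vector: one family of nonnegative weights
represents all the moments `⟨x, W ^ q x⟩` at once. -/
theorem exists_moment_eq_sum {W : Matrix (Fin m) (Fin m) ℝ} (hW : W.IsHermitian)
    (x : Fin m → ℝ) : ∃ c l : Fin m → ℝ, (∀ u, 0 ≤ c u) ∧
      ∀ q : ℕ, x ⬝ᵥ (W ^ q *ᵥ x) = ∑ u, c u * l u ^ q := by
  set U : Matrix (Fin m) (Fin m) ℝ := ↑hW.eigenvectorUnitary with hU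
  refine ⟨fun u => (Uᵀ *ᵥ x) u ^ 2, hW.eigenvalues, fun u => sq_nonneg _, fun q => ?_⟩
  rw [isHermitian_pow_eq hW q, ← hU, ← Matrix.mulVec_mulVec, ← Matrix.mulVec_mulVec,
    Matrix.dotProduct_mulVec, ← Matrix.mulVec_transpose]
  simp only [dotProduct, Matrix.mulVec_diagonal, Pi.pow_apply]
  exact Finset.sum_congr rfl fun u _ => by ring

theorem trace_pow_eq_sum_eigenvalues {W : Matrix (Fin m) (Fin m) ℝ} (hW : W.IsHermitian) (q : ℕ) :
    (W ^ q).trace = ∑ u, hW.eigenvalues u ^ q := by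
  have hU : (hW.eigenvectorUnitary : Matrix (Fin m) (Fin m) ℝ)ᵀ
      * (hW.eigenvectorUnitary : Matrix (Fin m) (Fin m) ℝ) = 1 :=
    Unitary.coe_star_mul_self hW.eigenvectorUnitary
  rw [isHermitian_pow_eq hW q, Matrix.trace_mul_comm, ← Matrix.mul_assoc, hU, Matrix.one_mul,
    Matrix.trace_diagonal]
  rfl

open scoped Matrix.Norms.L2Operator in
theorem specNorm_eq_norm_eigenvalues {W : Matrix (Fin m) (Fin m) ℝ} (hW : W.IsHermitian) :
    specNorm W = ‖hW.eigenvalues‖ := by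
  have h : W = (hW.eigenvectorUnitary : Matrix (Fin m) (Fin m) ℝ)
      * Matrix.diagonal hW.eigenvalues
      * (star hW.eigenvectorUnitary : Matrix.unitaryGroup (Fin m) ℝ) := by
    have h1 := isHermitian_pow_eq hW 1
    rwa [pow_one, pow_one] at h1
  calc specNorm W = ‖W‖ := Matrix.l2_opNorm_toEuclideanCLM W
    _ = ‖(hW.eigenvectorUnitary : Matrix (Fin m) (Fin m) ℝ)
      * Matrix.diagonal hW.eigenvalues
      * (star hW.eigenvectorUnitary : Matrix.unitaryGroup (Fin m) ℝ)‖ := congrArg _ h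
    _ = ‖hW.eigenvalues‖ := by
      rw [CStarRing.norm_mul_coe_unitary, CStarRing.norm_coe_unitary_mul, Matrix.l2_opNorm_diagonal]

theorem specNorm_nonneg (W : Matrix (Fin m) (Fin m) ℝ) : 0 ≤ specNorm W := norm_nonneg _

theorem specNorm_pow_le_trace [NeZero m] {W : Matrix (Fin m) (Fin m) ℝ} (hW : W.IsHermitian)
    (p : ℕ) : specNorm W ^ (2 * p) ≤ (W ^ (2 * p)).trace := by
  obtain ⟨u, hu⟩ := Finite.exists_max fun u => ‖hW.eigenvalues u‖
  have h1 : specNorm W ≤ ‖hW.eigenvalues u‖ := by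
    rw [specNorm_eq_norm_eigenvalues hW]
    exact (pi_norm_le_iff_of_nonneg (norm_nonneg _)).2 hu
  calc specNorm W ^ (2 * p) ≤ ‖hW.eigenvalues u‖ ^ (2 * p) :=
        pow_le_pow_left₀ (specNorm_nonneg W) h1 _
    _ = hW.eigenvalues u ^ (2 * p) := by
        rw [Real.norm_eq_abs, (even_two_mul p).pow_abs]
    _ ≤ ∑ u, hW.eigenvalues u ^ (2 * p) :=
        Finset.single_le_sum (f := fun u => hW.eigenvalues u ^ (2 * p))
          (fun v _ => (even_two_mul p).pow_nonneg _) (Finset.mem_univ u)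
    _ = (W ^ (2 * p)).trace := (trace_pow_eq_sum_eigenvalues hW _).symm

theorem trace_pow_even_nonneg {W : Matrix (Fin m) (Fin m) ℝ} (hW : W.IsHermitian) (p : ℕ) :
    0 ≤ (W ^ (2 * p)).trace := by
  rw [trace_pow_eq_sum_eigenvalues hW]
  exact Finset.sum_nonneg fun v _ => (even_two_mul p).pow_nonneg _

theorem euclNorm_sq (v : Fin m → ℝ) : euclNorm v ^ 2 = v ⬝ᵥ v := by
  rw [euclNorm, EuclideanSpace.norm_sq_eq]
  simp [dotProduct, sq]

theorem dotProduct_mulVec_le_specNorm (G : Matrix (Fin m) (Fin m) ℝ) (v : Fin m → ℝ) :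
    v ⬝ᵥ (G *ᵥ v) ≤ specNorm G * (v ⬝ᵥ v) := by
  have h := Matrix.inner_toEuclideanCLM G (WithLp.toLp 2 v) (WithLp.toLp 2 v)
  calc v ⬝ᵥ (G *ᵥ v) = _ := h.symm
    _ ≤ euclNorm v * (specNorm G * euclNorm v) :=
        (real_inner_le_norm _ _).trans
          (mul_le_mul_of_nonneg_left (ContinuousLinearMap.le_opNorm _ _) (norm_nonneg _))
    _ = specNorm G * (v ⬝ᵥ v) := by rw [← euclNorm_sq]; ring

theorem trace_mul_pow_even_le (G : Matrix (Fin m) (Fin m) ℝ) {W : Matrix (Fin m) (Fin m) ℝ}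
    (hW : W.IsHermitian) (p : ℕ) :
    (G * W ^ (2 * p)).trace ≤ specNorm G * (W ^ (2 * p)).trace := by
  set Y := W ^ p with hY
  have hYt : Yᵀ = Y := by
    have : Wᵀ = W := hW
    rw [hY, Matrix.transpose_pow, this]
  have hYs : ∀ i j, Y i j = Y j i := fun i j => congrFun (congrFun hYt j) i
  have hpow : W ^ (2 * p) = Y * Y := by rw [hY, two_mul, pow_add]
  have h1 : (G * W ^ (2 * p)).trace = ∑ j, Y j ⬝ᵥ (G *ᵥ Y j) := by
    rw [hpow, ← Matrix.mul_assoc, Matrix.trace_mul_comm]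
    refine Finset.sum_congr rfl fun j _ => ?_
    rw [Matrix.diag_apply, Matrix.mul_apply]
    refine Finset.sum_congr rfl fun k _ => ?_
    rw [Matrix.mul_apply, Matrix.mulVec, dotProduct]
    simp only [hYs _ j]
  have h2 : (W ^ (2 * p)).trace = ∑ j, Y j ⬝ᵥ Y j := by
    rw [hpow]
    refine Finset.sum_congr rfl fun j _ => ?_
    rw [Matrix.diag_apply, Matrix.mul_apply]
    simp only [hYs _ j]
    rfl
  rw [h1, h2, Finset.mul_sum]
  exact Finset.sum_le_sum fun j _ => dotProduct_mulVec_le_specNorm G (Y j)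

theorem pow_sub_pow_eq_sum {R : Type*} [Ring R] (W Y : R) (N : ℕ) :
    W ^ (N + 1) - Y ^ (N + 1) = ∑ q ∈ Finset.range (N + 1), W ^ q * (W - Y) * Y ^ (N - q) := by
  induction N with
  | zero => simp
  | succ N ih =>
    rw [Finset.sum_range_succ, Nat.sub_self, pow_zero, mul_one]
    have : ∑ q ∈ Finset.range (N + 1), W ^ q * (W - Y) * Y ^ (N + 1 - q)
        = (W ^ (N + 1) - Y ^ (N + 1)) * Y := by
      rw [ih, Finset.sum_mul]
      refine Finset.sum_congr rfl fun q hq => ?_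
      rw [mul_assoc _ (Y ^ _) Y, ← pow_succ]
      congr 2
      have := Finset.mem_range.1 hq
      omega
    rw [this, pow_succ W (N + 1), pow_succ Y (N + 1)]
    noncomm_ring

/-- Moments of two spectral measures of the same mass: mixed products of moments are dominated by
the top moment, after summing over all splittings of an even total degree. -/
theorem sum_moment_mul_moment_le {W Y : Matrix (Fin m) (Fin m) ℝ} (hW : W.IsHermitian)
    (hY : Y.IsHermitian) (x : Fin m → ℝ) (p : ℕ) :
    2 * ∑ q ∈ Finset.range (2 * p + 1), (x ⬝ᵥ (W ^ q *ᵥ x)) * (x ⬝ᵥ (Y ^ (2 * p - q) *ᵥ x))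
      ≤ (2 * p + 1) * (x ⬝ᵥ x) * (x ⬝ᵥ (W ^ (2 * p) *ᵥ x) + x ⬝ᵥ (Y ^ (2 * p) *ᵥ x)) := by
  obtain ⟨a, l, ha, hal⟩ := exists_moment_eq_sum hW x
  obtain ⟨b, k, hb, hbk⟩ := exists_moment_eq_sum hY x
  have ha0 : x ⬝ᵥ x = ∑ u, a u := by simpa using hal 0
  have hb0 : x ⬝ᵥ x = ∑ u, b u := by simpa using hbk 0
  have pair : ∀ q ∈ Finset.range (2 * p + 1),
      (x ⬝ᵥ (W ^ q *ᵥ x)) * (x ⬝ᵥ (Y ^ (2 * p - q) *ᵥ x))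
        + (x ⬝ᵥ (W ^ (2 * p - q) *ᵥ x)) * (x ⬝ᵥ (Y ^ q *ᵥ x))
      ≤ (x ⬝ᵥ x) * (x ⬝ᵥ (W ^ (2 * p) *ᵥ x) + x ⬝ᵥ (Y ^ (2 * p) *ᵥ x)) := by
    intro q hq
    have hq' : q + (2 * p - q) = 2 * p := by have := Finset.mem_range.1 hq; omega
    -- `⟨x, x⟩` is the mass of either spectral measure, so both sides are sums over pairs of atoms.
    rw [mul_add]
    nth_rewrite 1 [hb0]
    rw [ha0]
    simp only [hal, hbk, Finset.sum_mul_sum]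
    rw [Finset.sum_comm (f := fun i j => b i * (a j * l j ^ (2 * p))),
      ← Finset.sum_add_distrib, ← Finset.sum_add_distrib]
    refine Finset.sum_le_sum fun u _ => ?_
    rw [← Finset.sum_add_distrib, ← Finset.sum_add_distrib]
    refine Finset.sum_le_sum fun v _ => ?_
    have h := mul_le_mul_of_nonneg_left
      (pow_mul_pow_add_le_of_even (by rw [hq']; exact even_two_mul p :
        Even (q + (2 * p - q))) (l u) (k v)) (mul_nonneg (ha u) (hb v))
    rw [hq'] at h
    linarith
  have hrefl := Finset.sum_range_reflect
    (fun q => (x ⬝ᵥ (W ^ q *ᵥ x)) * (x ⬝ᵥ (Y ^ (2 * p - q) *ᵥ x))) (2 * p + 1)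
  have hrefl' : ∑ q ∈ Finset.range (2 * p + 1),
      (x ⬝ᵥ (W ^ (2 * p - q) *ᵥ x)) * (x ⬝ᵥ (Y ^ q *ᵥ x))
      = ∑ q ∈ Finset.range (2 * p + 1),
        (x ⬝ᵥ (W ^ q *ᵥ x)) * (x ⬝ᵥ (Y ^ (2 * p - q) *ᵥ x)) := by
    rw [← hrefl]
    refine Finset.sum_congr rfl fun q hq => ?_
    have := Finset.mem_range.1 hq
    have e1 : 2 * p + 1 - 1 - q = 2 * p - q := by omega
    have e2 : 2 * p - (2 * p - q) = q := by omega
    simp only [e1, e2]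
  have h := Finset.sum_le_sum pair
  rw [Finset.sum_add_distrib, hrefl', Finset.sum_const, Finset.card_range, nsmul_eq_mul] at h
  push_cast at h
  linarith

/-! ### Signed Gram matrices and the noncommutative Khintchine inequality -/

/-- The signed Gram matrix `∑ l, s l • x l (x l)ᵀ` of the rows `x l`. -/
noncomputable def signedGram (s : Fin n → ℝ) (x : Matrix (Fin n) (Fin m) ℝ) :
    Matrix (Fin m) (Fin m) ℝ :=
  ∑ l, s l • Matrix.vecMulVec (x l) (x l)

theorem signedGram_isHermitian (s : Fin n → ℝ) (x : Matrix (Fin n) (Fin m) ℝ) :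
    (signedGram s x).IsHermitian := by
  change (signedGram s x)ᵀ = _
  simp [signedGram, Matrix.transpose_sum, Matrix.transpose_vecMulVec]

theorem signedGram_one (x : Matrix (Fin n) (Fin m) ℝ) :
    signedGram (fun _ => 1) x = xᵀ * x := by
  ext i j
  simp [signedGram, Matrix.sum_apply, Matrix.vecMulVec_apply, Matrix.mul_apply]

theorem trace_signedGram_mul (s : Fin n → ℝ) (x : Matrix (Fin n) (Fin m) ℝ)
    (N : Matrix (Fin m) (Fin m) ℝ) :
    (signedGram s x * N).trace = ∑ l, s l * (x l ⬝ᵥ (N *ᵥ x l)) := by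
  simp only [signedGram, Finset.sum_mul, Matrix.trace_sum, Matrix.smul_mul, Matrix.trace_smul,
    smul_eq_mul]
  refine Finset.sum_congr rfl fun l _ => ?_
  rw [Matrix.trace_mul_comm, Matrix.mul_vecMulVec, Matrix.trace_vecMulVec, dotProduct_comm]

/-- A vector of signs, as a real vector. -/
def signVec (ε : Fin n → ℤˣ) : Fin n → ℝ := fun i => ((ε i : ℤ) : ℝ)

theorem signVec_sq (ε : Fin n → ℤˣ) (i : Fin n) : signVec ε i * signVec ε i = 1 := by
  rcases Int.units_eq_one_or (ε i) with h | h <;> simp [signVec, h]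

theorem signVec_flip_self (ε : Fin n → ℤˣ) (i : Fin n) :
    signVec (ε * Pi.mulSingle i (-1)) i = - signVec ε i := by
  simp [signVec]

theorem signedGram_sub_flip (ε : Fin n → ℤˣ) (i : Fin n) (x : Matrix (Fin n) (Fin m) ℝ) :
    signedGram (signVec ε) x - signedGram (signVec (ε * Pi.mulSingle i (-1))) x
      = (2 * signVec ε i) • Matrix.vecMulVec (x i) (x i) := by
  rw [signedGram, signedGram, ← Finset.sum_sub_distrib, Finset.sum_eq_single i]
  · rw [signVec_flip_self, ← sub_smul]
    congr 1
    ring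
  · intro j _ hj
    simp [signVec, Pi.mulSingle_eq_of_ne hj]
  · simp

theorem dotProduct_mul_vecMulVec_mul_mulVec (W Y : Matrix (Fin m) (Fin m) ℝ) (x : Fin m → ℝ) :
    x ⬝ᵥ ((W * Matrix.vecMulVec x x * Y) *ᵥ x) = (x ⬝ᵥ (W *ᵥ x)) * (x ⬝ᵥ (Y *ᵥ x)) := by
  rw [Matrix.mul_vecMulVec, Matrix.vecMulVec_mul, Matrix.vecMulVec_mulVec,
    ← Matrix.dotProduct_mulVec]
  simp [mul_comm]

/-- Discrete integration by parts for one sign: flipping the sign `i` shows that the average of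
`ε i ⟨x i, S ε ^ (2p+1) x i⟩` is controlled by the moment of order `2p`. -/
theorem sum_signVec_mul_moment_le (x : Matrix (Fin n) (Fin m) ℝ) (i : Fin n) (p : ℕ) :
    ∑ ε : Fin n → ℤˣ, signVec ε i * (x i ⬝ᵥ (signedGram (signVec ε) x ^ (2 * p + 1) *ᵥ x i))
      ≤ (2 * p + 1) * (x i ⬝ᵥ x i) *
        ∑ ε : Fin n → ℤˣ, x i ⬝ᵥ (signedGram (signVec ε) x ^ (2 * p) *ᵥ x i) := by
  set S : (Fin n → ℤˣ) → Matrix (Fin m) (Fin m) ℝ := fun ε => signedGram (signVec ε) x with hS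
  set φ : (Fin n → ℤˣ) → (Fin n → ℤˣ) := fun ε => ε * Pi.mulSingle i (-1) with hφ
  have flip : ∀ f : (Fin n → ℤˣ) → ℝ, ∑ ε, f (φ ε) = ∑ ε, f ε := fun f =>
    Fintype.sum_equiv (Equiv.mulRight (Pi.mulSingle i (-1))) _ _ fun ε => rfl
  have h1 : 2 * ∑ ε, signVec ε i * (x i ⬝ᵥ (S ε ^ (2 * p + 1) *ᵥ x i))
      = ∑ ε, signVec ε i * (x i ⬝ᵥ ((S ε ^ (2 * p + 1) - S (φ ε) ^ (2 * p + 1)) *ᵥ x i)) := by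
    rw [two_mul]
    nth_rewrite 2 [← flip]
    rw [← Finset.sum_add_distrib]
    refine Finset.sum_congr rfl fun ε _ => ?_
    rw [hφ, signVec_flip_self, Matrix.sub_mulVec, dotProduct_sub]
    ring
  have h2 : ∀ ε, signVec ε i * (x i ⬝ᵥ ((S ε ^ (2 * p + 1) - S (φ ε) ^ (2 * p + 1)) *ᵥ x i))
      = 2 * ∑ q ∈ Finset.range (2 * p + 1),
        (x i ⬝ᵥ (S ε ^ q *ᵥ x i)) * (x i ⬝ᵥ (S (φ ε) ^ (2 * p - q) *ᵥ x i)) := by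
    intro ε
    rw [pow_sub_pow_eq_sum, signedGram_sub_flip, Matrix.sum_mulVec, dotProduct_sum,
      Finset.mul_sum, Finset.mul_sum]
    refine Finset.sum_congr rfl fun q _ => ?_
    rw [Matrix.mul_smul, Matrix.smul_mul, Matrix.smul_mulVec, dotProduct_smul,
      dotProduct_mul_vecMulVec_mul_mulVec, smul_eq_mul]
    linear_combination (2 * ((x i ⬝ᵥ (S ε ^ q *ᵥ x i)) *
      (x i ⬝ᵥ (S (φ ε) ^ (2 * p - q) *ᵥ x i)))) * signVec_sq ε i
  have h3 := Finset.sum_le_sum fun ε (_ : ε ∈ Finset.univ) =>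
    (h2 ε).trans_le (sum_moment_mul_moment_le (signedGram_isHermitian (signVec ε) x)
      (signedGram_isHermitian (signVec (φ ε)) x) (x i) p)
  rw [← h1, ← Finset.mul_sum, Finset.sum_add_distrib,
    flip fun ε => x i ⬝ᵥ (signedGram (signVec ε) x ^ (2 * p) *ᵥ x i)] at h3
  linarith

theorem moment_even_nonneg {W : Matrix (Fin m) (Fin m) ℝ} (hW : W.IsHermitian)
    (x : Fin m → ℝ) (p : ℕ) : 0 ≤ x ⬝ᵥ (W ^ (2 * p) *ᵥ x) := by
  obtain ⟨c, l, hc, h⟩ := exists_moment_eq_sum hW x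
  rw [h]
  exact Finset.sum_nonneg fun u _ => mul_nonneg (hc u) ((even_two_mul p).pow_nonneg _)

/-- The recursion behind the Khintchine inequality: since the summands have rank one,
`∑ i, |x i| ^ 2 • x i (x i)ᵀ` is at most `a` times the Gram matrix, and the latter leaves the trace
as a factor `specNorm (xᵀ * x)`. -/
theorem sum_trace_signedGram_pow_succ_le (x : Matrix (Fin n) (Fin m) ℝ) {a v : ℝ}
    (ha : 0 ≤ a) (hx : ∀ i, x i ⬝ᵥ x i ≤ a) (hv : a * specNorm (xᵀ * x) ≤ v) (p : ℕ) :
    ∑ ε : Fin n → ℤˣ, (signedGram (signVec ε) x ^ (2 * (p + 1))).trace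
      ≤ (2 * p + 1) * v * ∑ ε : Fin n → ℤˣ, (signedGram (signVec ε) x ^ (2 * p)).trace := by
  have hH := fun ε : Fin n → ℤˣ => signedGram_isHermitian (signVec ε) x
  calc ∑ ε : Fin n → ℤˣ, (signedGram (signVec ε) x ^ (2 * (p + 1))).trace
      = ∑ i, ∑ ε : Fin n → ℤˣ,
          signVec ε i * (x i ⬝ᵥ (signedGram (signVec ε) x ^ (2 * p + 1) *ᵥ x i)) := by
        rw [Finset.sum_comm]
        refine Finset.sum_congr rfl fun ε _ => ?_
        rw [show 2 * (p + 1) = (2 * p + 1) + 1 by ring, pow_succ' _ (2 * p + 1),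
          trace_signedGram_mul]
    _ ≤ ∑ i, (2 * p + 1) * a *
        ∑ ε : Fin n → ℤˣ, x i ⬝ᵥ (signedGram (signVec ε) x ^ (2 * p) *ᵥ x i) := by
        refine Finset.sum_le_sum fun i _ => (sum_signVec_mul_moment_le x i p).trans ?_
        refine mul_le_mul_of_nonneg_right (mul_le_mul_of_nonneg_left (hx i) (by positivity)) ?_
        exact Finset.sum_nonneg fun ε _ => moment_even_nonneg (hH ε) _ _
    _ = (2 * p + 1) * ∑ ε : Fin n → ℤˣ,
          a * (xᵀ * x * signedGram (signVec ε) x ^ (2 * p)).trace := by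
        rw [← Finset.mul_sum, Finset.sum_comm, mul_assoc, Finset.mul_sum]
        congr 1
        refine Finset.sum_congr rfl fun ε _ => ?_
        rw [← signedGram_one, trace_signedGram_mul]
        simp
    _ ≤ (2 * p + 1) * ∑ ε : Fin n → ℤˣ, v * (signedGram (signVec ε) x ^ (2 * p)).trace := by
        refine mul_le_mul_of_nonneg_left (Finset.sum_le_sum fun ε _ => ?_) (by positivity)
        calc _ ≤ a * (specNorm (xᵀ * x) * (signedGram (signVec ε) x ^ (2 * p)).trace) :=
              mul_le_mul_of_nonneg_left (trace_mul_pow_even_le _ (hH ε) p) ha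
          _ ≤ _ := by
              rw [← mul_assoc]
              exact mul_le_mul_of_nonneg_right hv (trace_pow_even_nonneg (hH ε) p)
    _ = _ := by rw [← Finset.mul_sum, mul_assoc]

/-- Noncommutative Khintchine inequality for even moments and rank-one summands, with the moments
`(2p)! / (2 ^ p p!)` of a standard Gaussian as constants. -/
theorem sum_specNorm_signedGram_pow_le [NeZero m] (x : Matrix (Fin n) (Fin m) ℝ) {a v : ℝ}
    (ha : 0 ≤ a) (hx : ∀ i, x i ⬝ᵥ x i ≤ a) (hv : a * specNorm (xᵀ * x) ≤ v) (p : ℕ) :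
    ∑ ε : Fin n → ℤˣ, specNorm (signedGram (signVec ε) x) ^ (2 * p)
      ≤ (2 : ℝ) ^ n * (m * (((2 * p).factorial : ℝ) / (2 ^ p * p.factorial) * v ^ p)) := by
  have hv0 : 0 ≤ v := (mul_nonneg ha (specNorm_nonneg _)).trans hv
  refine (Finset.sum_le_sum fun ε _ =>
    specNorm_pow_le_trace (signedGram_isHermitian (signVec ε) x) p).trans ?_
  induction p with
  | zero => simp
  | succ p ih =>
    refine (sum_trace_signedGram_pow_succ_le x ha hx hv p).trans ?_
    refine (mul_le_mul_of_nonneg_left ih (by positivity)).trans_eq ?_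
    rw [show 2 * (p + 1) = 2 * p + 1 + 1 by ring, Nat.factorial_succ (2 * p + 1),
      Nat.factorial_succ (2 * p), Nat.factorial_succ p]
    push_cast
    field_simp
    ring

end LinearAlgebra

/-! ### Real moments between even ones -/

/-- The even Gaussian moments are at most `√2 (2k / e) ^ k`: a ratio of two terms of the decreasing
Stirling sequence. -/
theorem factorial_two_mul_div_le {k : ℕ} (hk : k ≠ 0) :
    ((2 * k).factorial : ℝ) / (2 ^ k * k.factorial) ≤ √2 * (2 * k / Real.exp 1) ^ k := by
  have hmono : Stirling.stirlingSeq (2 * k) ≤ Stirling.stirlingSeq k := by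
    obtain ⟨j, rfl⟩ := Nat.exists_eq_succ_of_ne_zero hk
    exact Stirling.stirlingSeq'_antitone (show j ≤ 2 * j + 1 by omega)
  have hk0 : (0 : ℝ) < k := by positivity
  have h4 : √(2 * ((2 * k : ℕ) : ℝ)) = √2 * √(2 * (k : ℝ)) := by
    rw [← Real.sqrt_mul (by norm_num)]; push_cast; rfl
  rw [Stirling.stirlingSeq, Stirling.stirlingSeq, h4] at hmono
  have hs : 0 < √(2 * (k : ℝ)) := by positivity
  have hs2 : 0 < √(2 : ℝ) := by positivity
  have he := Real.exp_pos 1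
  rw [div_le_div_iff₀ (by positivity) (by positivity)] at hmono
  rw [div_le_iff₀ (by positivity)]
  have hc : 0 < √(2 * (k : ℝ)) * (k / Real.exp 1) ^ k := by positivity
  refine le_of_mul_le_mul_right (hmono.trans_eq ?_) hc
  push_cast
  rw [two_mul k, pow_add (2 * (k : ℝ) / Real.exp 1), div_pow, div_pow, mul_pow]
  field_simp

/-- The chord of the convex function `y ↦ y log (2y)` over `[k, k + 1]` exceeds it by at most
`t (1 - t) / (k + t)`, which is at most `3 - 2 √2 < (log 2) / 4`. This is the loss that turns the
constant `√2` of the even moments into `2 ^ (3 / 4)`. -/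
theorem chord_le {k t : ℝ} (hk : 1 ≤ k) (ht0 : 0 ≤ t) (ht1 : t ≤ 1) :
    (1 - t) * (k * Real.log (2 * k)) + t * ((k + 1) * Real.log (2 * (k + 1)))
      ≤ (k + t) * Real.log (2 * (k + t)) + Real.log 2 / 4 := by
  have hkt : 0 < k + t := by linarith
  have h1 : Real.log (2 * k) - Real.log (2 * (k + t)) ≤ - t / (k + t) := by
    rw [← Real.log_div (by positivity) (by positivity)]
    refine (Real.log_le_sub_one_of_pos (by positivity)).trans_eq ?_
    field_simp; ring
  have h2 : Real.log (2 * (k + 1)) - Real.log (2 * (k + t)) ≤ (1 - t) / (k + t) := by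
    rw [← Real.log_div (by positivity) (by positivity)]
    refine (Real.log_le_sub_one_of_pos (by positivity)).trans_eq ?_
    field_simp; ring
  have h3 : t * (1 - t) / (k + t) ≤ Real.log 2 / 4 := by
    rw [div_le_iff₀ hkt]
    have := Real.log_two_gt_d9
    -- For `k = 1` this is a quadratic in `t` without real roots, with vertex near `0.4134`.
    nlinarith [sq_nonneg (t - 0.4134)]
  have h4 := mul_le_mul_of_nonneg_left h1 (mul_nonneg (sub_nonneg.2 ht1) (by linarith : 0 ≤ k))
  have h5 := mul_le_mul_of_nonneg_left h2 (mul_nonneg ht0 (by linarith : 0 ≤ k + 1))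
  have h6 : (1 - t) * k * (- t / (k + t)) + t * (k + 1) * ((1 - t) / (k + t))
    = t * (1 - t) / (k + t) := by field_simp; ring
  linarith

/-- Log-convexity of moments: a bound for the moment of order `(1 - t) p + t q` of a nonnegative
function on a finite set, from bounds for the moments of order `p` and `q`. -/
theorem sum_rpow_le_of_sum_rpow_le {ι : Type*} (s : Finset ι) (Z : ι → ℝ) (hZ : ∀ i ∈ s, 0 ≤ Z i)
    {p q t a b N : ℝ} (hp : 0 < p) (hq : 0 < q) (ht0 : 0 ≤ t) (ht1 : t ≤ 1)
    (ha : 0 < a) (hb : 0 < b)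
    (hpa : ∑ i ∈ s, Z i ^ p ≤ N * a) (hqb : ∑ i ∈ s, Z i ^ q ≤ N * b) :
    ∑ i ∈ s, Z i ^ ((1 - t) * p + t * q) ≤ N * (a ^ (1 - t) * b ^ t) := by
  have hC : 0 < a ^ (1 - t) * b ^ t := by positivity
  -- Weighted AM-GM for the two powers of `Z`, normalised by their bounds.
  have hpt : ∀ i ∈ s, Z i ^ ((1 - t) * p + t * q)
      ≤ (a ^ (1 - t) * b ^ t) * ((1 - t) * (Z i ^ p / a) + t * (Z i ^ q / b)) := by
    intro i hi
    have hz := hZ i hi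
    have h := Real.geom_mean_le_arith_mean2_weighted (sub_nonneg.2 ht1) ht0
      (div_nonneg (Real.rpow_nonneg hz p) ha.le) (div_nonneg (Real.rpow_nonneg hz q) hb.le)
      (by ring)
    refine le_trans (le_of_eq ?_) (mul_le_mul_of_nonneg_left h hC.le)
    rw [Real.div_rpow (by positivity) ha.le, Real.div_rpow (by positivity) hb.le,
      ← Real.rpow_mul hz, ← Real.rpow_mul hz,
      Real.rpow_add_of_nonneg hz (mul_nonneg (sub_nonneg.2 ht1) hp.le) (mul_nonneg ht0 hq.le),
      mul_comm p, mul_comm q]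
    field_simp
  refine (Finset.sum_le_sum hpt).trans ?_
  rw [← Finset.mul_sum, Finset.sum_add_distrib, ← Finset.mul_sum, ← Finset.mul_sum,
    ← Finset.sum_div, ← Finset.sum_div, mul_comm N]
  refine mul_le_mul_of_nonneg_left ?_ hC.le
  have h1 : (∑ i ∈ s, Z i ^ p) / a ≤ N := (div_le_iff₀ ha).2 hpa
  have h2 : (∑ i ∈ s, Z i ^ q) / b ≤ N := (div_le_iff₀ hb).2 hqb
  nlinarith [mul_le_mul_of_nonneg_left h1 (sub_nonneg.2 ht1), mul_le_mul_of_nonneg_left h2 ht0]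

/-- Rudelson's inequality: the Khintchine inequality for rank-one summands at a real exponent
`r ≥ 2`. -/
theorem sum_specNorm_signedGram_rpow_le {n m : ℕ} [NeZero m] (x : Matrix (Fin n) (Fin m) ℝ)
    {a v r : ℝ} (ha : 0 ≤ a) (hx : ∀ i, x i ⬝ᵥ x i ≤ a) (hv : a * specNorm (xᵀ * x) ≤ v)
    (hv0 : 0 < v) (hr : 2 ≤ r) :
    ∑ ε : Fin n → ℤˣ, specNorm (signedGram (signVec ε) x) ^ r
      ≤ (2 : ℝ) ^ n * (m * ((2 : ℝ) ^ (3 / 4 : ℝ) * r ^ (r / 2) * Real.exp (-r / 2)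
        * v ^ (r / 2))) := by
  have hm : (0 : ℝ) < m := Nat.cast_pos.2 (NeZero.pos m)
  set k := ⌊r / 2⌋₊ with hk
  set t := r / 2 - k with ht
  have hk1 : 1 ≤ k := Nat.le_floor (by push_cast; linarith)
  have hk1' : (1 : ℝ) ≤ k := by exact_mod_cast hk1
  have ht0 : 0 ≤ t := sub_nonneg.2 (Nat.floor_le (by linarith))
  have ht1 : t ≤ 1 := by
    have := Nat.lt_floor_add_one (r / 2)
    linarith
  -- `g k` bounds the normalised moment of order `2k`; the exponent `r` lies in `[2k, 2k + 2]`.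
  set g : ℕ → ℝ := fun k => √2 * (2 * k / Real.exp 1) ^ k * v ^ k with hg
  have hgpos : ∀ k : ℕ, 1 ≤ k → 0 < g k := fun k hk => by
    have : (0 : ℝ) < k := by exact_mod_cast hk
    positivity
  have heven : ∀ k : ℕ, 1 ≤ k → ∑ ε : Fin n → ℤˣ,
      specNorm (signedGram (signVec ε) x) ^ (2 * k : ℝ) ≤ (2 : ℝ) ^ n * m * g k := by
    intro k hk
    have h := sum_specNorm_signedGram_pow_le x ha hx hv k
    have e : ∀ ε : Fin n → ℤˣ, specNorm (signedGram (signVec ε) x) ^ (2 * k : ℝ)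
        = specNorm (signedGram (signVec ε) x) ^ (2 * k) := fun ε => by
      rw [← Real.rpow_natCast]; push_cast; rfl
    simp only [e]
    refine h.trans ?_
    rw [← mul_assoc]
    exact mul_le_mul_of_nonneg_left (mul_le_mul_of_nonneg_right
      (factorial_two_mul_div_le (by omega)) (by positivity)) (by positivity)
  have h1 := heven (k + 1) (by omega)
  have h := sum_rpow_le_of_sum_rpow_le Finset.univ _ (fun ε _ => specNorm_nonneg _)
    (by positivity) (by positivity) ht0 ht1 (hgpos k hk1) (hgpos (k + 1) (by omega))
    (heven k hk1) h1
  rw [show (1 - t) * (2 * (k : ℝ)) + t * (2 * ((k + 1 : ℕ) : ℝ)) = r by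
    push_cast; rw [ht]; ring] at h
  refine h.trans ?_
  rw [mul_assoc]
  refine mul_le_mul_of_nonneg_left (mul_le_mul_of_nonneg_left ?_ hm.le) (by positivity)
  have hlog : ∀ k : ℕ, 1 ≤ k → Real.log (g k)
      = Real.log 2 / 2 + k * Real.log (2 * k) - k + k * Real.log v := fun k hk => by
    have : (0 : ℝ) < k := by exact_mod_cast hk
    rw [hg]
    simp only
    rw [Real.log_mul (by positivity) (by positivity), Real.log_mul (by positivity) (by positivity),
      Real.log_pow, Real.log_pow, Real.log_div (by positivity) (by positivity), Real.log_exp,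
      Real.log_sqrt (by norm_num)]
    ring
  have hgk := hgpos k hk1
  have hgk1 := hgpos (k + 1) (by omega)
  have hr0 : 0 < r := by linarith
  have hR : Real.log ((2 : ℝ) ^ (3 / 4 : ℝ) * r ^ (r / 2) * Real.exp (-r / 2) * v ^ (r / 2))
      = 3 / 4 * Real.log 2 + r / 2 * Real.log r + -r / 2 + r / 2 * Real.log v := by
    rw [Real.log_mul (by positivity) (by positivity), Real.log_mul (by positivity) (by positivity),
      Real.log_mul (by positivity) (by positivity), Real.log_rpow (by norm_num),
      Real.log_rpow hr0, Real.log_rpow hv0, Real.log_exp]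
  rw [← Real.log_le_log_iff (by positivity) (by positivity), hR,
    Real.log_mul (by positivity) (by positivity), Real.log_rpow hgk, Real.log_rpow hgk1,
    hlog k hk1, hlog (k + 1) (by omega)]
  have hch := chord_le hk1' ht0 ht1
  have hkt : (k : ℝ) + t = r / 2 := by rw [ht]; ring
  have hr2 : 2 * (r / 2) = r := by ring
  rw [hkt, hr2] at hch
  have hkt' : t = r / 2 - k := ht
  push_cast
  linear_combination hch + (Real.log v - 1) * hkt

/-! ### Symmetrization -/

/-- Bounded random vectors: continuous functions of them are integrable. -/
theorem integrable_of_continuous_of_norm_le {E : Type*} [NormedAddCommGroup E] [ProperSpace E]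
    [MeasurableSpace E] [BorelSpace E] {F : Type*} [NormedAddCommGroup F]
    {ρ : Measure E} [IsFiniteMeasure ρ] [SecondCountableTopologyEither E F]
    {b : ℝ} (hb : ∀ᵐ x ∂ρ, ‖x‖ ≤ b) {f : E → F}
    (hf : Continuous f) : Integrable f ρ := by
  have h : ∀ᵐ x ∂ρ, x ∈ Metric.closedBall (0 : E) b := by
    filter_upwards [hb] with x hx
    simpa using hx
  rw [← Measure.restrict_eq_self_of_ae_mem h]
  exact hf.continuousOn.integrableOn_compact (isCompact_closedBall 0 b)

variable {n m : ℕ}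

theorem specNorm_add_le (M N : Matrix (Fin m) (Fin m) ℝ) :
    specNorm (M + N) ≤ specNorm M + specNorm N := by
  rw [specNorm, map_add]; exact norm_add_le _ _

theorem specNorm_sub_le (M N : Matrix (Fin m) (Fin m) ℝ) :
    specNorm (M - N) ≤ specNorm M + specNorm N := by
  rw [specNorm, map_sub]; exact norm_sub_le _ _

theorem specNorm_smul (c : ℝ) (M : Matrix (Fin m) (Fin m) ℝ) :
    specNorm (c • M) = |c| * specNorm M := by
  rw [specNorm, map_smul, norm_smul]; rfl

theorem continuous_toEuclideanCLM :
    Continuous fun M : Matrix (Fin m) (Fin m) ℝ =>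
      Matrix.toEuclideanCLM (n := Fin m) (𝕜 := ℝ) M :=
  LinearMap.continuous_of_finiteDimensional
    (Matrix.toEuclideanCLM (n := Fin m) (𝕜 := ℝ)).toAlgEquiv.toLinearMap

theorem continuous_specNorm : Continuous (specNorm : Matrix (Fin m) (Fin m) ℝ → ℝ) :=
  continuous_toEuclideanCLM.norm

theorem continuous_signedGram (s : Fin n → ℝ) :
    Continuous fun x : Fin n → Fin m → ℝ => signedGram s (Matrix.of x) := by
  unfold signedGram
  refine continuous_finsetSum _ fun l _ => ?_
  have hl : Continuous fun x : Fin n → Fin m → ℝ => Matrix.vecMulVec (x l) (x l) :=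
    (continuous_apply l).matrix_vecMulVec (continuous_apply l)
  exact hl.const_smul (s l)

theorem integral_toEuclideanCLM {E : Type*} [MeasurableSpace E] {ρ : Measure E}
    {N : E → Matrix (Fin m) (Fin m) ℝ} (hN : ∀ i j, Integrable (fun x => N x i j) ρ) :
    ∫ x, Matrix.toEuclideanCLM (n := Fin m) (𝕜 := ℝ) (N x) ∂ρ
      = Matrix.toEuclideanCLM (n := Fin m) (𝕜 := ℝ)
        (Matrix.of fun i j => ∫ x, N x i j ∂ρ) := by
  have key : ∀ M : Matrix (Fin m) (Fin m) ℝ, Matrix.toEuclideanCLM (n := Fin m) (𝕜 := ℝ) M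
      = ∑ i, ∑ j, M i j • Matrix.toEuclideanCLM (n := Fin m) (𝕜 := ℝ) (Matrix.single i j 1) := by
    intro M
    conv_lhs => rw [Matrix.matrix_eq_sum_single M]
    simp only [map_sum, ← map_smul, Matrix.smul_single, smul_eq_mul, mul_one]
  simp only [key (N _)]
  rw [key (Matrix.of _), integral_finsetSum _ fun i _ => integrable_finsetSum _ fun j _ =>
    (hN i j).smul_const _]
  refine Finset.sum_congr rfl fun i _ => ?_
  rw [integral_finsetSum _ fun j _ => (hN i j).smul_const _]
  refine Finset.sum_congr rfl fun j _ => ?_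
  rw [integral_smul_const, Matrix.of_apply]

theorem rpow_add_le_mul_rpow_add_rpow {a b r : ℝ} (ha : 0 ≤ a) (hb : 0 ≤ b) (hr : 1 ≤ r) :
    (a + b) ^ r ≤ 2 ^ (r - 1) * (a ^ r + b ^ r) := by
  have h := NNReal.rpow_add_le_mul_rpow_add_rpow ⟨a, ha⟩ ⟨b, hb⟩ hr
  exact_mod_cast h

theorem convexOn_norm_rpow {E : Type*} [NormedAddCommGroup E] [NormedSpace ℝ E] {r : ℝ}
    (hr : 1 ≤ r) : ConvexOn ℝ Set.univ fun x : E => ‖x‖ ^ r := by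
  refine ⟨convex_univ, fun x _ y _ a b ha hb hab => ?_⟩
  have h1 : ‖a • x + b • y‖ ≤ a * ‖x‖ + b * ‖y‖ := by
    refine (norm_add_le _ _).trans_eq ?_
    rw [norm_smul, norm_smul, Real.norm_of_nonneg ha, Real.norm_of_nonneg hb]
  exact (Real.rpow_le_rpow (norm_nonneg _) h1 (by linarith)).trans
    ((convexOn_rpow hr).2 (norm_nonneg x) (norm_nonneg y) ha hb hab)

/-- Jensen's inequality: the mean of a random matrix may be replaced by the random matrix itself,
under the integral. -/
theorem specNorm_sub_mean_rpow_le {E : Type*} [MeasurableSpace E] {ρ : Measure E}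
    [IsProbabilityMeasure ρ] {N : E → Matrix (Fin m) (Fin m) ℝ}
    (hN : ∀ i j, Integrable (fun x => N x i j) ρ) (M : Matrix (Fin m) (Fin m) ℝ) {r : ℝ}
    (hr : 1 ≤ r)
    (hi : Integrable (fun y => Matrix.toEuclideanCLM (n := Fin m) (𝕜 := ℝ) (M - N y)) ρ)
    (hir : Integrable (fun y => specNorm (M - N y) ^ r) ρ) :
    specNorm (M - Matrix.of fun i j => ∫ y, N y i j ∂ρ) ^ r
      ≤ ∫ y, specNorm (M - N y) ^ r ∂ρ := by
  have h := (convexOn_norm_rpow (E := EuclideanSpace ℝ (Fin m) →L[ℝ] EuclideanSpace ℝ (Fin m))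
    hr).map_integral_le (μ := ρ)
    (continuous_norm.rpow_const fun _ => Or.inr (by linarith)).continuousOn isClosed_univ
    (Filter.Eventually.of_forall fun _ => Set.mem_univ _) hi hir
  rw [integral_toEuclideanCLM (N := fun y => M - N y)
    fun i j => (integrable_const (M i j)).sub (hN i j)] at h
  refine le_trans (le_of_eq ?_) h
  rw [specNorm]
  congr 3
  ext i j
  simp only [Matrix.sub_apply, Matrix.of_apply]
  rw [integral_sub (integrable_const _) (hN i j)]
  simp

/-- Exchange of the rows `l` with `ε l = -1` between two matrices. -/
def rowSwap (ε : Fin n → ℤˣ) (z : (Fin n → Fin m → ℝ) × (Fin n → Fin m → ℝ)) :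
    (Fin n → Fin m → ℝ) × (Fin n → Fin m → ℝ) :=
  (fun l => if ε l = 1 then z.1 l else z.2 l, fun l => if ε l = 1 then z.2 l else z.1 l)

/-- The rows being independent, two independent copies of the matrix may exchange any of them. -/
theorem measurePreserving_rowSwap (μ : Fin n → Measure (Fin m → ℝ))
    [∀ l, IsProbabilityMeasure (μ l)] (ε : Fin n → ℤˣ) :
    MeasurePreserving (rowSwap ε) ((Measure.pi μ).prod (Measure.pi μ))
      ((Measure.pi μ).prod (Measure.pi μ)) := by
  have he := measurePreserving_arrowProdEquivProdArrow (Fin m → ℝ) (Fin m → ℝ) (Fin n) μ μ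
  have hrow : MeasurePreserving
      (fun (a : Fin n → (Fin m → ℝ) × (Fin m → ℝ)) l =>
        (if ε l = 1 then id else Prod.swap : (Fin m → ℝ) × (Fin m → ℝ) → _) (a l))
      (Measure.pi fun l => (μ l).prod (μ l)) (Measure.pi fun l => (μ l).prod (μ l)) := by
    refine measurePreserving_pi _ _ fun l => ?_
    split_ifs
    · exact MeasurePreserving.id _
    · exact Measure.measurePreserving_swap
  have h := he.comp (hrow.comp (he.symm _))
  convert h using 1
  funext z
  refine Prod.ext ?_ ?_ <;> funext l <;> by_cases hl : ε l = 1 <;>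
    simp [rowSwap, hl, MeasurableEquiv.arrowProdEquivProdArrow, Equiv.arrowProdEquivProdArrow]

/-- Exchanging the rows with sign `-1` turns the difference of two Gram matrices into the difference
of the signed ones. -/
theorem signedGram_one_rowSwap_sub (ε : Fin n → ℤˣ)
    (z : (Fin n → Fin m → ℝ) × (Fin n → Fin m → ℝ)) :
    signedGram (fun _ => 1) (Matrix.of (rowSwap ε z).1)
        - signedGram (fun _ => 1) (Matrix.of (rowSwap ε z).2)
      = signedGram (signVec ε) (Matrix.of z.1) - signedGram (signVec ε) (Matrix.of z.2) := by
  simp only [signedGram, ← Finset.sum_sub_distrib]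
  refine Finset.sum_congr rfl fun l _ => ?_
  rcases Int.units_eq_one_or (ε l) with h | h
  · have e1 : Matrix.of (rowSwap ε z).1 l = Matrix.of z.1 l := if_pos h
    have e2 : Matrix.of (rowSwap ε z).2 l = Matrix.of z.2 l := if_pos h
    simp [signVec, h, e1, e2]
  · have hne : ε l ≠ 1 := by rw [h]; decide
    have e1 : Matrix.of (rowSwap ε z).1 l = Matrix.of z.2 l := if_neg hne
    have e2 : Matrix.of (rowSwap ε z).2 l = Matrix.of z.1 l := if_neg hne
    simp [signVec, h, e1, e2]
    abel

/-- Symmetrization: the deviation of the Gram matrix of independent bounded rows from its mean is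
dominated, in `L ^ r`, by twice the Gram matrix with arbitrary fixed signs. -/
theorem integral_specNorm_sub_mean_rpow_le (μ : Fin n → Measure (Fin m → ℝ))
    [∀ l, IsProbabilityMeasure (μ l)] {b : ℝ} (hb : ∀ᵐ x ∂Measure.pi μ, ‖x‖ ≤ b) {r : ℝ}
    (hr : 1 ≤ r) (ε : Fin n → ℤˣ) :
    ∫ x, specNorm (signedGram (fun _ => 1) (Matrix.of x)
        - meanGram (Measure.pi μ) fun x => Matrix.of x) ^ r ∂Measure.pi μ
      ≤ 2 ^ r * ∫ x, specNorm (signedGram (signVec ε) (Matrix.of x)) ^ r ∂Measure.pi μ := by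
  set ν := Measure.pi μ with hν
  have hr0 : 0 ≤ r := by linarith
  have hcr : ∀ {E : Type} [TopologicalSpace E] {N : E → Matrix (Fin m) (Fin m) ℝ},
      Continuous N → Continuous fun x => specNorm (N x) ^ r := fun hN =>
    (continuous_specNorm.comp hN).rpow_const fun _ => Or.inr hr0
  have hb2 : ∀ᵐ z ∂ν.prod ν, ‖z‖ ≤ b := by
    have h1 := Measure.quasiMeasurePreserving_fst (μ := ν) (ν := ν) |>.ae hb
    have h2 := Measure.quasiMeasurePreserving_snd (μ := ν) (ν := ν) |>.ae hb
    filter_upwards [h1, h2] with z hz1 hz2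
    exact max_le hz1 hz2
  set D : (Fin n → ℝ) → (Fin n → Fin m → ℝ) × (Fin n → Fin m → ℝ) → ℝ := fun s z =>
    specNorm (signedGram s (Matrix.of z.1) - signedGram s (Matrix.of z.2)) ^ r with hD
  have hDc : ∀ s, Continuous (D s) := fun s =>
    hcr (((continuous_signedGram s).comp continuous_fst).sub
      ((continuous_signedGram s).comp continuous_snd))
  have hDi : ∀ s, Integrable (D s) (ν.prod ν) := fun s =>
    integrable_of_continuous_of_norm_le hb2 (hDc s)
  have hSi : ∀ s, Integrable (fun x => specNorm (signedGram s (Matrix.of x)) ^ r) ν := fun s =>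
    integrable_of_continuous_of_norm_le hb (hcr (continuous_signedGram s))
  have hmean : (meanGram ν fun x => Matrix.of x)
      = Matrix.of fun i j => ∫ x, signedGram (fun _ => 1) (Matrix.of x) i j ∂ν := by
    simp only [signedGram_one]; rfl
  calc ∫ x, specNorm (signedGram (fun _ => 1) (Matrix.of x)
          - meanGram ν fun x => Matrix.of x) ^ r ∂ν
      ≤ ∫ x, ∫ y, D (fun _ => 1) (x, y) ∂ν ∂ν := by
        refine integral_mono (integrable_of_continuous_of_norm_le hb
          (hcr ((continuous_signedGram _).sub continuous_const)))
          (hDi _).integral_prod_left fun x => ?_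
        have hc := (continuous_const (y := signedGram (fun _ => 1) (Matrix.of x))).sub
          (continuous_signedGram (n := n) (m := m) fun _ => 1)
        rw [hmean]
        exact specNorm_sub_mean_rpow_le
          (fun i j => integrable_of_continuous_of_norm_le hb
            ((continuous_signedGram _).matrix_elem i j)) _ hr
          (integrable_of_continuous_of_norm_le hb (continuous_toEuclideanCLM.comp hc))
          (integrable_of_continuous_of_norm_le hb (hcr hc))
    _ = ∫ z, D (fun _ => 1) z ∂ν.prod ν := (integral_prod _ (hDi _)).symm
    _ = ∫ z, D (fun _ => 1) (rowSwap ε z) ∂ν.prod ν := by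
        have h := measurePreserving_rowSwap μ ε
        rw [← hν] at h
        conv_lhs => rw [← h.map_eq]
        exact integral_map h.measurable.aemeasurable (hDc _).aestronglyMeasurable
    _ = ∫ z, D (signVec ε) z ∂ν.prod ν := by
        simp only [hD, signedGram_one_rowSwap_sub]
    _ ≤ ∫ z, 2 ^ (r - 1) * (specNorm (signedGram (signVec ε) (Matrix.of z.1)) ^ r
          + specNorm (signedGram (signVec ε) (Matrix.of z.2)) ^ r) ∂ν.prod ν := by
        refine integral_mono (hDi _)
          (((hSi _).comp_fst ν).add ((hSi _).comp_snd ν) |>.const_mul _) fun z => ?_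
        exact (Real.rpow_le_rpow (specNorm_nonneg _) (specNorm_sub_le _ _) hr0).trans
          (rpow_add_le_mul_rpow_add_rpow (specNorm_nonneg _) (specNorm_nonneg _) hr)
    _ = 2 ^ r * ∫ x, specNorm (signedGram (signVec ε) (Matrix.of x)) ^ r ∂ν := by
        rw [integral_const_mul, integral_add ((hSi _).comp_fst ν) ((hSi _).comp_snd ν),
          integral_fun_fst (fun x => specNorm (signedGram (signVec ε) (Matrix.of x)) ^ r),
          integral_fun_snd (fun x => specNorm (signedGram (signVec ε) (Matrix.of x)) ^ r)]
        rw [Real.rpow_sub_one (by norm_num)]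
        simp
        ring

/-! ### The self-bounding moment inequality -/

theorem tau_sq : tau ^ 2 = tau / 2 + 1 := by
  have h : √(17 : ℝ) ^ 2 = 17 := Real.sq_sqrt (by norm_num)
  rw [tau]
  linear_combination h / 16

theorem one_lt_tau : 1 < tau := by
  have h : (4 : ℝ) < √17 := Real.lt_sqrt_of_sq_lt (by norm_num)
  rw [tau]
  linarith

/-- For `s ≤ 1 / 2` the positive root of `x ^ 2 = s ^ 2 (1 + x)` is at most `τ s`. -/
theorem le_tau_mul_of_sq_le {x s : ℝ} (hs0 : 0 ≤ s) (hs : s ≤ 1 / 2)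
    (h : x ^ 2 ≤ s ^ 2 * (1 + x)) : x ≤ tau * s := by
  by_contra! hlt
  have ht := one_lt_tau
  have h1 : s ^ 2 ≤ tau * s := by nlinarith
  have h2 : 0 ≤ (x - tau * s) * (x + tau * s - s ^ 2) :=
    mul_nonneg (by linarith) (by nlinarith)
  have h3 : 0 ≤ tau * s ^ 2 * (1 / 2 - s) :=
    mul_nonneg (by positivity) (by linarith)
  have h4 : (x - tau * s) * (x + tau * s - s ^ 2) + tau * s ^ 2 * (1 / 2 - s) ≤ 0 := by
    have := tau_sq
    nlinarith
  have h5 : (x - tau * s) * (x + tau * s - s ^ 2) = 0 := by linarith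
  have h6 : tau * s ^ 2 * (1 / 2 - s) = 0 := by linarith
  rcases mul_eq_zero.1 h5 with h7 | h7 <;> nlinarith

/-- A weak form of Minkowski's inequality in `L ^ (r / 2)`, with the `L ^ r` norm on the right. -/
theorem integral_one_add_rpow_le {Ω : Type*} [MeasurableSpace Ω] {ρ : Measure Ω}
    [IsProbabilityMeasure ρ] {X : Ω → ℝ} (hX : ∀ ω, 0 ≤ X ω) {r x : ℝ} (hr : 2 ≤ r) (hx : 0 < x)
    (hi : Integrable (fun ω => X ω ^ r) ρ) (hi' : Integrable (fun ω => (1 + X ω) ^ (r / 2)) ρ)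
    (hxr : ∫ ω, X ω ^ r ∂ρ = x ^ r) :
    ∫ ω, (1 + X ω) ^ (r / 2) ∂ρ ≤ (1 + x) ^ (r / 2) := by
  have hxr0 : 0 < x ^ r := Real.rpow_pos_of_pos hx r
  have hpt : ∀ ω, (1 + X ω) ^ (r / 2) ≤ (1 + x) ^ (r / 2)
      * (1 / (1 + x) + x / (1 + x) * ((1 + X ω ^ r / x ^ r) / 2)) := by
    intro ω
    have hy : 0 ≤ X ω / x := div_nonneg (hX ω) hx.le
    -- `1 + X = (1 + x) * (convex combination of 1 and X / x)`
    have hconv := (convexOn_rpow (show 1 ≤ r / 2 by linarith)).2 (show (1 : ℝ) ∈ Set.Ici 0 by simp)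
      hy (show 0 ≤ 1 / (1 + x) by positivity) (show 0 ≤ x / (1 + x) by positivity)
      (by field_simp)
    simp only [smul_eq_mul, Real.one_rpow, mul_one] at hconv
    have hsq : (X ω / x) ^ (r / 2) ≤ (1 + X ω ^ r / x ^ r) / 2 := by
      have : X ω ^ r / x ^ r = ((X ω / x) ^ (r / 2)) ^ 2 := by
        rw [← Real.div_rpow (hX ω) hx.le, ← Real.rpow_natCast, ← Real.rpow_mul hy]
        congr 1; push_cast; ring
      rw [this]
      nlinarith [sq_nonneg ((X ω / x) ^ (r / 2) - 1)]
    have hsplit : 1 + X ω = (1 + x) * (1 / (1 + x) + x / (1 + x) * (X ω / x)) := by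
      field_simp
    rw [hsplit, Real.mul_rpow (by positivity) (by positivity)]
    exact mul_le_mul_of_nonneg_left (hconv.trans (by gcongr)) (by positivity)
  have hint : Integrable (fun ω => (1 + X ω ^ r / x ^ r) / 2) ρ :=
    ((integrable_const _).add (hi.div_const _)).div_const _
  have hint' : Integrable
      (fun ω => 1 / (1 + x) + x / (1 + x) * ((1 + X ω ^ r / x ^ r) / 2)) ρ :=
    (integrable_const _).add (hint.const_mul _)
  refine (integral_mono hi' (hint'.const_mul _) hpt).trans_eq ?_
  rw [integral_const_mul, integral_add (integrable_const _) (hint.const_mul _),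
    integral_const_mul, integral_const, integral_div,
    integral_add (integrable_const _) (hi.div_const _), integral_const,
    integral_div, hxr, div_self hxr0.ne']
  simp
  field_simp

/-- A variable with `E[X ^ r] ≤ S E[(1 + X) ^ (r / 2)]` has `x = ‖X‖_r` satisfying
`x ^ 2 ≤ S ^ (2 / r) (1 + x)`, which is solved for `x`. -/
theorem rpow_inv_integral_le_of_self_bound {Ω : Type*} [MeasurableSpace Ω] {ρ : Measure Ω}
    [IsProbabilityMeasure ρ] {X : Ω → ℝ} (hX : ∀ ω, 0 ≤ X ω) {r S : ℝ} (hr : 2 ≤ r)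
    (hS0 : 0 ≤ S) (hS : S ^ (1 / r) ≤ 1 / 2)
    (hi : Integrable (fun ω => X ω ^ r) ρ) (hi' : Integrable (fun ω => (1 + X ω) ^ (r / 2)) ρ)
    (h : ∫ ω, X ω ^ r ∂ρ ≤ S * ∫ ω, (1 + X ω) ^ (r / 2) ∂ρ) :
    (∫ ω, X ω ^ r ∂ρ) ^ (1 / r) ≤ tau * S ^ (1 / r) := by
  have hr0 : 0 < r := by linarith
  have hs0 : 0 ≤ S ^ (1 / r) := Real.rpow_nonneg hS0 _
  have hI : 0 ≤ ∫ ω, X ω ^ r ∂ρ := integral_nonneg fun ω => Real.rpow_nonneg (hX ω) r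
  set x := (∫ ω, X ω ^ r ∂ρ) ^ (1 / r) with hxdef
  have hxr : ∫ ω, X ω ^ r ∂ρ = x ^ r := by
    rw [hxdef, ← Real.rpow_mul hI, one_div_mul_cancel hr0.ne', Real.rpow_one]
  rcases (Real.rpow_nonneg hI (1 / r)).eq_or_lt with h0 | hx
  · rw [hxdef, ← h0]
    exact mul_nonneg (by linarith [one_lt_tau]) hs0
  refine le_tau_mul_of_sq_le hs0 hS ?_
  have h1 : x ^ r ≤ S * (1 + x) ^ (r / 2) := by
    rw [← hxr]
    exact h.trans (mul_le_mul_of_nonneg_left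
      (integral_one_add_rpow_le hX hr hx hi hi' hxr) hS0)
  have hx1 : 0 ≤ 1 + x := by linarith [show 0 < x from hx]
  have h2 := Real.rpow_le_rpow (by positivity) h1 (show 0 ≤ 2 / r by positivity)
  rw [Real.mul_rpow hS0 (by positivity), ← Real.rpow_mul (le_of_lt hx), ← Real.rpow_mul hx1,
    mul_div_cancel₀ _ hr0.ne', show r / 2 * (2 / r) = 1 by field_simp, Real.rpow_one,
    Real.rpow_two, show 2 / r = 1 / r * 2 by ring, Real.rpow_mul hS0, Real.rpow_two] at h2
  exact h2

/-! ### Moments and tails of the normalised deviation -/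

variable {n m : ℕ}

theorem abs_le_euclNorm (v : Fin m → ℝ) (i : Fin m) : |v i| ≤ euclNorm v :=
  PiLp.norm_apply_le (WithLp.toLp 2 v : EuclideanSpace ℝ (Fin m)) i

theorem norm_le_of_euclNorm_le {x : Fin n → Fin m → ℝ} {b : ℝ} (hb : 0 ≤ b)
    (h : ∀ l, euclNorm (x l) ≤ b) : ‖x‖ ≤ b :=
  (pi_norm_le_iff_of_nonneg hb).2 fun l => (pi_norm_le_iff_of_nonneg hb).2 fun i =>
    (abs_le_euclNorm (x l) i).trans (h l)

theorem Sig_nonneg {K Λ r : ℝ} (hK : 0 ≤ K) (hr : 0 ≤ r) : 0 ≤ Sig m n K Λ r := by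
  unfold Sig; positivity

/-- Rescaling of the constant of Rudelson's inequality, with `σ ^ 2 = K ^ 2 m * (n Λ)`. -/
theorem Sig_mul_rpow {K Λ r : ℝ} (hn : 0 < n) (hK : 0 ≤ K) (hΛ : 0 < Λ) :
    (n * Λ) ^ r * Sig m n K Λ r
      = 2 ^ r * (m * ((2 : ℝ) ^ (3 / 4 : ℝ) * r ^ (r / 2) * Real.exp (-r / 2)
        * (K ^ 2 * m * (n * Λ)) ^ (r / 2))) := by
  have hn' : (0 : ℝ) < n := Nat.cast_pos.2 hn
  have hb : (n * Λ) * (2 * K / √Λ * √((m : ℝ) / n)) = 2 * √(K ^ 2 * m * (n * Λ)) := by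
    have h1 : √Λ * √Λ = Λ := Real.mul_self_sqrt hΛ.le
    have h2 : √(n : ℝ) * √n = n := Real.mul_self_sqrt hn'.le
    have h3 : 0 < √Λ := Real.sqrt_pos.2 hΛ
    have h4 : 0 < √(n : ℝ) := Real.sqrt_pos.2 hn'
    rw [Real.sqrt_div' _ hn'.le, Real.sqrt_mul (by positivity), Real.sqrt_mul (by positivity),
      Real.sqrt_sq hK, Real.sqrt_mul hn'.le]
    nth_rewrite 1 [← h1, ← h2]
    field_simp
  have hs : (2 * √(K ^ 2 * m * (n * Λ))) ^ r = 2 ^ r * (K ^ 2 * m * (n * Λ)) ^ (r / 2) := by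
    rw [Real.mul_rpow (by norm_num) (Real.sqrt_nonneg _), Real.sqrt_eq_rpow,
      ← Real.rpow_mul (by positivity)]
    congr 2
    ring
  rw [← hb, Real.mul_rpow (by positivity) (by positivity)] at hs
  unfold Sig
  linear_combination ((2 : ℝ) ^ (3 / 4 : ℝ) * m * r ^ (r / 2) * Real.exp (-r / 2)) * hs

theorem continuous_normDev (ρ : Measure (Fin n → Fin m → ℝ)) :
    Continuous fun x => normDev ρ (fun x => Matrix.of x) x := by
  unfold normDev
  simp only [← signedGram_one]
  have h := (continuous_signedGram (n := n) (m := m) fun _ => 1).sub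
    (continuous_const (y := meanGram ρ fun x : Fin n → Fin m → ℝ => Matrix.of x))
  exact continuous_specNorm.comp (h.const_smul (1 / ((n : ℝ) * Lam ρ fun x => Matrix.of x)))

theorem normDev_nonneg {Ω : Type*} [MeasurableSpace Ω] (P : Measure Ω)
    (A : Ω → Matrix (Fin n) (Fin m) ℝ) (ω : Ω) : 0 ≤ normDev P A ω :=
  specNorm_nonneg _

theorem specNorm_gram_sub_mean_eq {Ω : Type*} [MeasurableSpace Ω] (P : Measure Ω)
    (A : Ω → Matrix (Fin n) (Fin m) ℝ) (h : 0 < n * Lam P A) (ω : Ω) :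
    specNorm ((A ω)ᵀ * A ω - meanGram P A) = n * Lam P A * normDev P A ω := by
  rw [normDev, specNorm_smul, abs_of_pos (one_div_pos.2 h), one_div,
    mul_inv_cancel_left₀ h.ne']

theorem natCast_mul_Lam {Ω : Type*} [MeasurableSpace Ω] (P : Measure Ω)
    (A : Ω → Matrix (Fin n) (Fin m) ℝ) (hn : 0 < n) : n * Lam P A = specNorm (meanGram P A) := by
  have : (n : ℝ) ≠ 0 := by positivity
  rw [Lam]
  field_simp

theorem integrable_rpow_normDev {ρ : Measure (Fin n → Fin m → ℝ)} [IsFiniteMeasure ρ] {b : ℝ}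
    (hb : ∀ᵐ x ∂ρ, ‖x‖ ≤ b) {r : ℝ} (hr : 0 ≤ r) (c : ℝ) :
    Integrable (fun x => (c + normDev ρ (fun x => Matrix.of x) x) ^ r) ρ :=
  integrable_of_continuous_of_norm_le hb
    ((continuous_const.add (continuous_normDev ρ)).rpow_const fun _ => Or.inr hr)

/-- Symmetrization followed by Rudelson's inequality for fixed rows; the spectral norm of the Gram
matrix left over by the latter is at most `n Λ (1 + X)`. -/
theorem integral_normDev_rpow_le [NeZero m] (hn : 0 < n) (μ : Fin n → Measure (Fin m → ℝ))
    [∀ l, IsProbabilityMeasure (μ l)] {K r : ℝ} (hK : 0 < K) (hr : 2 ≤ r)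
    (hrow : ∀ᵐ x ∂Measure.pi μ, ∀ l, euclNorm (x l) ≤ K * √(m : ℝ))
    (hLam : 0 < Lam (Measure.pi μ) fun x => Matrix.of x) :
    ∫ x, normDev (Measure.pi μ) (fun x => Matrix.of x) x ^ r ∂Measure.pi μ
      ≤ Sig m n K (Lam (Measure.pi μ) fun x => Matrix.of x) r
        * ∫ x, (1 + normDev (Measure.pi μ) (fun x => Matrix.of x) x) ^ (r / 2)
          ∂Measure.pi μ := by
  have hm : (0 : ℝ) < m := Nat.cast_pos.2 (NeZero.pos m)
  have hr0 : 0 ≤ r := by linarith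
  set ν := Measure.pi μ with hν
  set Λ := Lam ν fun x => Matrix.of x with hΛ
  set X := normDev ν fun x => Matrix.of x with hX
  have hX0 : ∀ x, 0 ≤ X x := normDev_nonneg _ _
  have hc : 0 < n * Λ := mul_pos (Nat.cast_pos.2 hn) hLam
  have hb : ∀ᵐ x ∂ν, ‖x‖ ≤ K * √(m : ℝ) := by
    filter_upwards [hrow] with x hx using norm_le_of_euclNorm_le (by positivity) hx
  set C := (2 : ℝ) ^ (3 / 4 : ℝ) * r ^ (r / 2) * Real.exp (-r / 2) with hC
  have hdev : ∀ x, specNorm (signedGram (fun _ => 1) (Matrix.of x)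
      - meanGram ν fun x => Matrix.of x) = n * Λ * X x := fun x => by
    rw [signedGram_one]
    exact specNorm_gram_sub_mean_eq ν (fun x => Matrix.of x) hc x
  have hgram : ∀ x : Fin n → Fin m → ℝ,
      specNorm ((Matrix.of x)ᵀ * Matrix.of x) ≤ n * Λ * (1 + X x) := fun x => by
    have h := specNorm_add_le (signedGram (fun _ => 1) (Matrix.of x)
      - meanGram ν fun x => Matrix.of x) (meanGram ν fun x => Matrix.of x)
    rw [sub_add_cancel, hdev, ← natCast_mul_Lam ν (fun x => Matrix.of x) hn, signedGram_one] at h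
    linarith
  have hsi : ∀ ε : Fin n → ℤˣ,
      Integrable (fun x => specNorm (signedGram (signVec ε) (Matrix.of x)) ^ r) ν := fun ε =>
    integrable_of_continuous_of_norm_le hb
      ((continuous_specNorm.comp (continuous_signedGram _)).rpow_const fun _ => Or.inr hr0)
  have hkhin : ∀ᵐ x ∂ν, ∑ ε : Fin n → ℤˣ, specNorm (signedGram (signVec ε) (Matrix.of x)) ^ r
      ≤ (2 : ℝ) ^ n * (m * (C * (K ^ 2 * m * (n * Λ)) ^ (r / 2))) * (1 + X x) ^ (r / 2) := by
    filter_upwards [hrow] with x hx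
    have hx' : ∀ i, Matrix.of x i ⬝ᵥ Matrix.of x i ≤ K ^ 2 * m := fun i => by
      have h := pow_le_pow_left₀ (norm_nonneg _) (hx i) 2
      rw [mul_pow, Real.sq_sqrt hm.le] at h
      exact (euclNorm_sq (x i)).symm.trans_le h
    have h1 : 0 < 1 + X x := by linarith [hX0 x]
    have h := sum_specNorm_signedGram_rpow_le (Matrix.of x) (by positivity) hx'
      (mul_le_mul_of_nonneg_left (hgram x) (by positivity)) (by positivity) hr
    rw [← mul_assoc (K ^ 2 * (m : ℝ)), Real.mul_rpow (by positivity) h1.le] at h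
    exact h.trans_eq (by ring)
  have hi1 : Integrable (fun x => (1 + X x) ^ (r / 2)) ν :=
    integrable_rpow_normDev hb (by linarith) 1
  have hsum : (2 : ℝ) ^ n * ((n * Λ) ^ r * ∫ x, X x ^ r ∂ν)
      ≤ 2 ^ r * ((2 : ℝ) ^ n * (m * (C * (K ^ 2 * m * (n * Λ)) ^ (r / 2)))
        * ∫ x, (1 + X x) ^ (r / 2) ∂ν) := by
    have hsym : ∀ ε : Fin n → ℤˣ, (n * Λ) ^ r * ∫ x, X x ^ r ∂ν
        ≤ 2 ^ r * ∫ x, specNorm (signedGram (signVec ε) (Matrix.of x)) ^ r ∂ν := fun ε => by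
      have h := integral_specNorm_sub_mean_rpow_le μ hb (by linarith : 1 ≤ r) ε
      rw [← hν] at h
      simp only [hdev, Real.mul_rpow hc.le (hX0 _)] at h
      rwa [integral_const_mul] at h
    calc (2 : ℝ) ^ n * ((n * Λ) ^ r * ∫ x, X x ^ r ∂ν)
        = ∑ _ε : Fin n → ℤˣ, (n * Λ) ^ r * ∫ x, X x ^ r ∂ν := by
          rw [Finset.sum_const, Finset.card_univ, nsmul_eq_mul]
          simp
      _ ≤ ∑ ε : Fin n → ℤˣ,
          2 ^ r * ∫ x, specNorm (signedGram (signVec ε) (Matrix.of x)) ^ r ∂ν :=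
          Finset.sum_le_sum fun ε _ => hsym ε
      _ = 2 ^ r * ∫ x, ∑ ε : Fin n → ℤˣ,
          specNorm (signedGram (signVec ε) (Matrix.of x)) ^ r ∂ν := by
          rw [← Finset.mul_sum, integral_finsetSum _ fun ε _ => hsi ε]
      _ ≤ _ := by
          rw [← integral_const_mul (_ * _)]
          exact mul_le_mul_of_nonneg_left (integral_mono_ae
            (integrable_finsetSum _ fun ε _ => hsi ε) (hi1.const_mul _) hkhin) (by positivity)
  have hfin := Sig_mul_rpow (m := m) (r := r) hn hK.le hLam
  have hpos : 0 < (2 : ℝ) ^ n * (n * Λ) ^ r := by positivity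
  refine le_of_mul_le_mul_left (le_trans (le_of_eq (by ring)) (hsum.trans_eq ?_)) hpos
  linear_combination (-(2 : ℝ) ^ n * ∫ x, (1 + X x) ^ (r / 2) ∂ν) * hfin

theorem pos_of_Lam_pos {Ω : Type*} [MeasurableSpace Ω] {P : Measure Ω}
    {A : Ω → Matrix (Fin n) (Fin m) ℝ} (h : 0 < Lam P A) : 0 < n ∧ 0 < m := by
  refine ⟨Nat.pos_of_ne_zero ?_, Nat.pos_of_ne_zero ?_⟩
  · rintro rfl
    simp [Lam] at h
  · rintro rfl
    have : specNorm (meanGram P A) = 0 := by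
      rw [Subsingleton.elim (meanGram P A) 0, specNorm, map_zero, norm_zero]
    simp [Lam, this] at h

section Transfer

variable {Ω : Type*} [MeasurableSpace Ω] {P : Measure Ω}
  {A : Ω → Matrix (Fin n) (Fin m) ℝ}

theorem meanGram_map (hmeas : ∀ l : Fin n, Measurable fun ω => (A ω l : Fin m → ℝ)) :
    meanGram (P.map fun ω l => A ω l) (fun x => Matrix.of x) = meanGram P A := by
  ext i j
  simp only [meanGram, Matrix.of_apply, ← signedGram_one]
  exact integral_map (measurable_pi_lambda _ hmeas).aemeasurable
    ((continuous_signedGram _).matrix_elem i j).aestronglyMeasurable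

theorem Lam_map (hmeas : ∀ l : Fin n, Measurable fun ω => (A ω l : Fin m → ℝ)) :
    Lam (P.map fun ω l => A ω l) (fun x => Matrix.of x) = Lam P A := by
  rw [Lam, meanGram_map hmeas, Lam]

theorem normDev_map (hmeas : ∀ l : Fin n, Measurable fun ω => (A ω l : Fin m → ℝ)) (ω : Ω) :
    normDev (P.map fun ω l => A ω l) (fun x => Matrix.of x) (fun l => A ω l)
      = normDev P A ω := by
  rw [normDev, Lam_map hmeas, meanGram_map hmeas]; rfl

theorem measurable_normDev (hmeas : ∀ l : Fin n, Measurable fun ω => (A ω l : Fin m → ℝ)) :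
    Measurable (normDev P A) := by
  simp only [← funext (normDev_map (P := P) hmeas)]
  exact (continuous_normDev _).measurable.comp (measurable_pi_lambda _ hmeas)

/-- The moment bound, transferred to `Ω` from the joint law of the rows, a product measure. -/
theorem integrable_and_moment_le [IsProbabilityMeasure P]
    (hmeas : ∀ l : Fin n, Measurable fun ω => (A ω l : Fin m → ℝ))
    (hindep : iIndepFun (fun (l : Fin n) (ω : Ω) => (A ω l : Fin m → ℝ)) P)
    {K : ℝ} (hK : 0 < K) (hrow : ∀ᵐ ω ∂P, ∀ l : Fin n, euclNorm (A ω l) ≤ K * √(m : ℝ))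
    (hLam : 0 < Lam P A) {r : ℝ} (hr : 2 ≤ r) (hS : Sig m n K (Lam P A) r ^ (1 / r) ≤ 1 / 2) :
    Integrable (fun ω => normDev P A ω ^ r) P ∧
      (∫ ω, normDev P A ω ^ r ∂P) ^ (1 / r) ≤ tau * Sig m n K (Lam P A) r ^ (1 / r) := by
  obtain ⟨hn, hm⟩ := pos_of_Lam_pos hLam
  have : NeZero m := ⟨hm.ne'⟩
  have hr0 : 0 ≤ r := by linarith
  set T : Ω → Fin n → Fin m → ℝ := fun ω l => A ω l with hT
  have hTm : Measurable T := measurable_pi_lambda _ hmeas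
  have hprob : ∀ l, IsProbabilityMeasure (P.map fun ω => (A ω l : Fin m → ℝ)) := fun l =>
    Measure.isProbabilityMeasure_map (hmeas l).aemeasurable
  set ν := Measure.pi fun l => P.map fun ω => (A ω l : Fin m → ℝ) with hνdef
  have hν : P.map T = ν :=
    (iIndepFun_iff_map_fun_eq_pi_map fun l => (hmeas l).aemeasurable).1 hindep
  have hLν : Lam ν (fun x => Matrix.of x) = Lam P A := hν ▸ Lam_map hmeas
  have hDν : ∀ ω, normDev ν (fun x => Matrix.of x) (T ω) = normDev P A ω :=
    hν ▸ normDev_map hmeas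
  have hset : MeasurableSet {x : Fin n → Fin m → ℝ | ∀ l, euclNorm (x l) ≤ K * √(m : ℝ)} := by
    rw [Set.ofPred_forall]
    refine MeasurableSet.iInter fun l => measurableSet_le ?_ measurable_const
    exact ((PiLp.continuous_toLp 2 _).comp (continuous_apply l)).norm.measurable
  have hrow' : ∀ᵐ x ∂ν, ∀ l, euclNorm (x l) ≤ K * √(m : ℝ) := by
    rw [← hν, ae_map_iff hTm.aemeasurable hset]
    exact hrow
  have hb : ∀ᵐ x ∂ν, ‖x‖ ≤ K * √(m : ℝ) := by
    filter_upwards [hrow'] with x hx using norm_le_of_euclNorm_le (by positivity) hx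
  have hi : Integrable (fun x => normDev ν (fun x => Matrix.of x) x ^ r) ν := by
    simpa using integrable_rpow_normDev hb hr0 0
  have hmom := rpow_inv_integral_le_of_self_bound (normDev_nonneg ν _) hr
    (Sig_nonneg (m := m) (n := n) (Λ := Lam P A) hK.le hr0) hS hi
    (integrable_rpow_normDev hb (by linarith) 1)
    (hLν ▸ integral_normDev_rpow_le hn _ hK hr hrow' (hLν.symm ▸ hLam))
  have hmap : ∀ f : (Fin n → Fin m → ℝ) → ℝ, Integrable f ν →
      Integrable (fun ω => f (T ω)) P ∧ ∫ ω, f (T ω) ∂P = ∫ x, f x ∂ν := by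
    intro f hf
    rw [← hν] at hf ⊢
    exact ⟨hf.comp_measurable hTm,
      (integral_map hTm.aemeasurable hf.aestronglyMeasurable).symm⟩
  obtain ⟨h1, h2⟩ := hmap _ hi
  simp only [hDν] at h1 h2
  exact ⟨h1, h2 ▸ hmom⟩

/-- Markov's inequality for `X ^ r`, at the level `2 τ K Λ ^ (-1/2) (m / n) ^ (1/2) √r`, chosen so
that all factors of the moment bound but `2 ^ (3/4) m e ^ (-r/2)` cancel. -/
theorem tail_le_of_moment_le [IsProbabilityMeasure P] {K : ℝ} (hK : 0 < K)
    (hLam : 0 < Lam P A) {r : ℝ} (hr : 2 ≤ r)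
    (hi : Integrable (fun ω => normDev P A ω ^ r) P)
    (hmom : (∫ ω, normDev P A ω ^ r ∂P) ^ (1 / r) ≤ tau * Sig m n K (Lam P A) r ^ (1 / r)) :
    P.real {ω | 2 * tau * K / √(Lam P A) * √((m : ℝ) / n) * √r < normDev P A ω}
      ≤ m * (2 : ℝ) ^ (3 / 4 : ℝ) * Real.exp (-r / 2) := by
  obtain ⟨hn, hm⟩ := pos_of_Lam_pos hLam
  have hn' : (0 : ℝ) < n := Nat.cast_pos.2 hn
  have hm' : (0 : ℝ) < m := Nat.cast_pos.2 hm
  have hr0 : 0 < r := by linarith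
  have htau : 0 < tau := by linarith [one_lt_tau]
  have hI : 0 ≤ ∫ ω, normDev P A ω ^ r ∂P :=
    integral_nonneg fun ω => Real.rpow_nonneg (normDev_nonneg P A ω) r
  set Λ := Lam P A
  set B := 2 * K / √Λ * √((m : ℝ) / n) with hB
  have hBpos : 0 < B := by positivity
  have ht : 2 * tau * K / √Λ * √((m : ℝ) / n) * √r = tau * B * √r := by rw [hB]; ring
  have hS0 : 0 ≤ Sig m n K Λ r := Sig_nonneg hK.le hr0.le
  have h1 : ∫ ω, normDev P A ω ^ r ∂P ≤ tau ^ r * Sig m n K Λ r := by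
    have h := Real.rpow_le_rpow (Real.rpow_nonneg hI _) hmom hr0.le
    rwa [Real.mul_rpow htau.le (Real.rpow_nonneg hS0 _), ← Real.rpow_mul hI,
      ← Real.rpow_mul hS0, one_div_mul_cancel hr0.ne', Real.rpow_one, Real.rpow_one] at h
  have hsr : √r ^ r = r ^ (r / 2) := by
    rw [Real.sqrt_eq_rpow, ← Real.rpow_mul hr0.le]; congr 1; ring
  have h2 : tau ^ r * Sig m n K Λ r
      = (tau * B * √r) ^ r * (m * (2 : ℝ) ^ (3 / 4 : ℝ) * Real.exp (-r / 2)) := by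
    rw [Real.mul_rpow (by positivity) (by positivity), Real.mul_rpow htau.le hBpos.le, hsr, Sig,
      ← hB]
    ring
  have hmarkov := mul_meas_ge_le_integral_of_nonneg
    (Filter.Eventually.of_forall fun ω => Real.rpow_nonneg (normDev_nonneg P A ω) r) hi
    ((tau * B * √r) ^ r)
  have hpos : 0 < (tau * B * √r) ^ r := by positivity
  rw [ht]
  refine (measureReal_mono fun ω hω => ?_).trans
    (le_of_mul_le_mul_left (hmarkov.trans (h1.trans_eq h2)) hpos)
  exact Real.rpow_le_rpow (by positivity) (le_of_lt hω) hr0.le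

end Transfer

end RandomGram

theorem mainTheorem5 {Ω : Type*} [MeasurableSpace Ω] (P : Measure Ω) [IsProbabilityMeasure P]
    (n m : ℕ) (A : Ω → Matrix (Fin n) (Fin m) ℝ)
    (hmeas : ∀ l : Fin n, Measurable fun ω => (A ω l : Fin m → ℝ))
    (hindep : iIndepFun (fun (l : Fin n) (ω : Ω) => (A ω l : Fin m → ℝ)) P)
    (K : ℝ) (hK : 1 ≤ K)
    (hrow : ∀ᵐ ω ∂P, ∀ l : Fin n, RandomGram.euclNorm (A ω l) ≤ K * Real.sqrt (m : ℝ))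
    (hLam : 0 < RandomGram.Lam P A) :
    (∀ r : ℝ, 2 ≤ r →
      RandomGram.Sig m n K (RandomGram.Lam P A) r ^ (1 / r) ≤ 1 / 2 →
        Integrable (fun ω => RandomGram.normDev P A ω ^ r) P ∧
        (∫ ω, RandomGram.normDev P A ω ^ r ∂P) ^ (1 / r)
          ≤ RandomGram.tau * RandomGram.Sig m n K (RandomGram.Lam P A) r ^ (1 / r)) ∧
    (∀ u : ℝ, Real.sqrt 2 ≤ u →
      RandomGram.Sig m n K (RandomGram.Lam P A) (u ^ 2) ^ (1 / u ^ 2) ≤ 1 / 2 →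
        P.real {ω | 2 * RandomGram.tau * K / Real.sqrt (RandomGram.Lam P A)
              * Real.sqrt ((m : ℝ) / (n : ℝ)) * u < RandomGram.normDev P A ω}
          ≤ (m : ℝ) * (2 : ℝ) ^ (3 / 4 : ℝ) * Real.exp (-u ^ 2 / 2)) ∧
    (∀ δ : ℝ, 0 < δ → δ < 1 / 2 →
      RandomGram.Sig m n K (RandomGram.Lam P A)
          (2 * Real.log ((2 : ℝ) ^ (3 / 4 : ℝ) * (m : ℝ) / δ))
          ^ (1 / (2 * Real.log ((2 : ℝ) ^ (3 / 4 : ℝ) * (m : ℝ) / δ))) ≤ 1 / 2 →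
        1 - δ ≤ P.real {ω | RandomGram.normDev P A ω
          ≤ 2 * RandomGram.tau * K / Real.sqrt (RandomGram.Lam P A)
              * Real.sqrt ((m : ℝ) / (n : ℝ))
              * Real.sqrt (2 * Real.log ((2 : ℝ) ^ (3 / 4 : ℝ) * (m : ℝ) / δ))}) := by
  have hK0 : 0 < K := by linarith
  have hmom : ∀ r : ℝ, 2 ≤ r →
      RandomGram.Sig m n K (RandomGram.Lam P A) r ^ (1 / r) ≤ 1 / 2 → _ := fun r hr hS =>
    RandomGram.integrable_and_moment_le hmeas hindep hK0 hrow hLam hr hS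
  have htail : ∀ r : ℝ, 2 ≤ r →
      RandomGram.Sig m n K (RandomGram.Lam P A) r ^ (1 / r) ≤ 1 / 2 → _ := fun r hr hS =>
    RandomGram.tail_le_of_moment_le hK0 hLam hr (hmom r hr hS).1 (hmom r hr hS).2
  refine ⟨hmom, fun u hu hS => ?_, fun δ hδ0 hδ hS => ?_⟩
  · have hu0 : 0 ≤ u := (Real.sqrt_nonneg 2).trans hu
    have h := htail (u ^ 2) ((Real.sqrt_le_left hu0).1 hu) hS
    rwa [Real.sqrt_sq hu0] at h
  · have hm : (1 : ℝ) ≤ m := by exact_mod_cast (RandomGram.pos_of_Lam_pos hLam).2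
    set q := (2 : ℝ) ^ (3 / 4 : ℝ) * (m : ℝ) / δ with hq
    -- `2 ^ (3 / 4) ≥ 3 / 2` gives `q ≥ 3 > e`, so that the exponent `2 log q` is at least `2`.
    have h2 : (3 / 2 : ℝ) ≤ (2 : ℝ) ^ (3 / 4 : ℝ) := by
      refine le_of_pow_le_pow_left₀ (n := 4) (by norm_num) (by positivity) ?_
      rw [← Real.rpow_natCast ((2 : ℝ) ^ (3 / 4 : ℝ)), ← Real.rpow_mul (by norm_num)]
      norm_num
    have hqe : Real.exp 1 ≤ q := by
      rw [hq, le_div_iff₀ hδ0]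
      have he := Real.exp_one_lt_d9
      nlinarith
    have hq0 : 0 < q := (Real.exp_pos 1).trans_le hqe
    have hr : 2 ≤ 2 * Real.log q := by
      have := (Real.le_log_iff_exp_le hq0).2 hqe
      linarith
    have h := htail _ hr hS
    have hval : (m : ℝ) * (2 : ℝ) ^ (3 / 4 : ℝ) * Real.exp (-(2 * Real.log q) / 2) = δ := by
      rw [show -(2 * Real.log q) / 2 = -Real.log q by ring, Real.exp_neg, Real.exp_log hq0, hq]
      have : (2 : ℝ) ^ (3 / 4 : ℝ) ≠ 0 := by positivity
      field_simp
    rw [hval] at h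
    set c := 2 * RandomGram.tau * K / Real.sqrt (RandomGram.Lam P A)
      * Real.sqrt ((m : ℝ) / (n : ℝ)) * Real.sqrt (2 * Real.log q)
    have hc := probReal_compl_eq_one_sub (μ := P) (s := {ω | c < RandomGram.normDev P A ω})
      (measurableSet_lt measurable_const (RandomGram.measurable_normDev hmeas))
    refine (sub_le_sub_left h 1).trans (hc.symm.le.trans (le_of_eq ?_))
    congr 1
    ext ω
    simp
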